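/- Let $R$ and $S$ be commutative rings with identity, let $f:R\to S$ be a (unital) ring homomorphism, and let $J$ be a non-zero proper ideal of $S$. Let $$R\bowtie^f J:=\{(r,f(r)+j)\mid r\in R,\ j\in J\}\subseteq R\times S$$ be the amalgamation of $R$ with $S$ along $J$ with respect to $f$ (a subring of $R\times S$). For a commutative ring $A$, let $Z(A)=\{x\in A\mid xy=0\text{ for some }y\in A\setminus\{0\}\}$ be its set of zero-divisors and $\mathrm{Nil}(A)$ its set of nilpotent elements, and let $\Gamma(A)$ be the zero-divisor graph of $A$: its vertices are the elements of $Z(A)\setminus\{0\}$, and two distinct vertices $x,y$ are adjacent if and only if $xy=0$. The diameter $\operatorname{diam}(G)$ of a graph $G$ is the supremum of the distances (lengths of shortest paths) between its vertices, where vertices that no path connects have distance $\infty$. Suppose that $R\bowtie^f J$ has finitely many elements. Then the following hold. 1. If $Z(R)$ is not an ideal of $R$, then $\operatorname{diam}(\Gamma(R\bowtie^f J))=3$. 2. If $J\nsubseteq \mathrm{Nil}(S)$ and $J\cap \mathrm{Nil}(S)\neq\{0\}$, then $\operatorname{diam}(\Gamma(R\bowtie^f J))=3$. -/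

import Mathlib

/-- The set `Z(A)` of zero-divisors of a commutative ring `A`
(so `0` is a zero-divisor as soon as `A` is nontrivial). -/
def zeroDivisors (A : Type*) [CommRing A] : Set A :=
  {x | ∃ y : A, y ≠ 0 ∧ x * y = 0}

theorem zeroDivisors_eq_compl (A : Type*) [CommRing A] :
    zeroDivisors A = ((nonZeroDivisors A : Submonoid A) : Set A)ᶜ := by
  ext x
  simp only [zeroDivisors, Set.mem_ofPred_eq, Set.mem_compl_iff, SetLike.mem_coe,
    mem_nonZeroDivisors_iff_right, not_forall]
  constructor
  · rintro ⟨y, hy, h⟩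
    exact ⟨y, by rwa [mul_comm], hy⟩
  · rintro ⟨y, h, hy⟩
    exact ⟨y, hy, by rwa [mul_comm]⟩

/-- The zero-divisor graph `Γ(A)`: the vertices are the non-zero zero-divisors of `A`, and
distinct vertices `x`, `y` are adjacent iff `x * y = 0`. -/
def zeroDivisorGraph (A : Type*) [CommRing A] :
    SimpleGraph {x : A // x ∈ zeroDivisors A ∧ x ≠ 0} where
  Adj x y := x ≠ y ∧ (x : A) * (y : A) = 0
  symm := ⟨fun x y h => ⟨h.1.symm, by rw [mul_comm]; exact h.2⟩⟩
  loopless := ⟨fun _ h => h.1 rfl⟩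

/-- The amalgamation `R ⋈^f J = {(r, f r + j) | r ∈ R, j ∈ J}`, a subring of `R × S`. -/
def amalgamation {R S : Type*} [CommRing R] [CommRing S] (f : R →+* S) (J : Ideal S) :
    Subring (R × S) where
  carrier := {p | ∃ r : R, ∃ j ∈ J, p = (r, f r + j)}
  mul_mem' := by
    rintro _ _ ⟨r, j, hj, rfl⟩ ⟨s, k, hk, rfl⟩
    refine ⟨r * s, f r * k + f s * j + j * k,
      J.add_mem (J.add_mem (J.mul_mem_left _ hk) (J.mul_mem_left _ hj)) (J.mul_mem_left _ hk), ?_⟩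
    rw [Prod.mk_mul_mk, map_mul]
    congr 1
    ring
  one_mem' := ⟨1, 0, J.zero_mem, by rw [map_one, add_zero]; rfl⟩
  add_mem' := by
    rintro _ _ ⟨r, j, hj, rfl⟩ ⟨s, k, hk, rfl⟩
    refine ⟨r + s, j + k, J.add_mem hj hk, ?_⟩
    rw [Prod.mk_add_mk, map_add]
    congr 1
    ring
  zero_mem' := ⟨0, 0, J.zero_mem, by rw [map_zero, add_zero]; rfl⟩
  neg_mem' := by
    rintro _ ⟨r, j, hj, rfl⟩
    refine ⟨-r, -j, J.neg_mem hj, ?_⟩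
    rw [Prod.neg_mk, map_neg]
    congr 1
    ring

/-!
Two zero-divisors `x`, `y` killed by `a ≠ 0` and `b ≠ 0` are joined by `x — a — b — y` if `a * b = 0`
and by `x — a * b — y` otherwise, so a zero-divisor graph never has diameter more than `3`
(`zeroDivisorGraph_ediam_le_three`). In a finite ring this bound is attained as soon as an
idempotent `e ≠ 1` splits off a factor `e A` that is not a field: if `e * a` is non-zero and not
invertible in `e A`, then `x = e * a + (1 - e)` and `y = e` are zero-divisors with
`x * y = e * a ≠ 0` and without a common non-zero annihilator, hence at distance at least `3`.
Given a non-trivial idempotent `e` and `a ≠ 0`, one of `e * a`, `(1 - e) * a` is non-zero; so it is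
enough that `a` divides neither `e` nor `1 - e`
(`zeroDivisorGraph_ediam_eq_three_of_isIdempotentElem`).

Idempotents come from powers: in a finite ring, an element that is neither nilpotent nor a unit
has a power that is an idempotent different from `0` and `1`.

* If the zero-divisors of `R` do not form an ideal, then the finite ring `R` has two non-units whose
  sum is a unit. Neither is nilpotent, so `R` has a non-trivial idempotent `r`, and `(r, f r)` is
  an idempotent of `R ⋈^f J`. For `0 ≠ j ∈ J`, the multiples of `(0, j)` have first coordinate `0`,
  while `r` and `1 - r` are non-zero.
* If `j ∈ J` is not nilpotent, then `(0, j)` is neither nilpotent nor a unit and yields a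
  non-trivial idempotent of `R ⋈^f J`; a non-zero nilpotent `k ∈ J` gives the nilpotent `(0, k)`,
  which divides no non-zero idempotent.
-/

/-- Vertices whose product is zero are at distance at most one, even if they coincide. -/
theorem zeroDivisorGraph_edist_le_one {A : Type*} [CommRing A]
    {x y : {x : A // x ∈ zeroDivisors A ∧ x ≠ 0}} (h : (x : A) * y = 0) :
    (zeroDivisorGraph A).edist x y ≤ 1 := by
  rw [SimpleGraph.edist_le_one_iff_adj_or_eq]
  by_cases hxy : x = y
  · exact Or.inr hxy
  · exact Or.inl ⟨hxy, h⟩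

theorem zeroDivisorGraph_ediam_le_three (A : Type*) [CommRing A] :
    (zeroDivisorGraph A).ediam ≤ 3 := by
  refine SimpleGraph.ediam_le_of_edist_le ?_
  rintro ⟨x, ⟨a, ha, hxa⟩, hx⟩ ⟨y, ⟨b, hb, hyb⟩, hy⟩
  set u : {x : A // x ∈ zeroDivisors A ∧ x ≠ 0} := ⟨x, ⟨a, ha, hxa⟩, hx⟩
  set v : {x : A // x ∈ zeroDivisors A ∧ x ≠ 0} := ⟨y, ⟨b, hb, hyb⟩, hy⟩
  by_cases hab : a * b = 0
  · let a' : {x : A // x ∈ zeroDivisors A ∧ x ≠ 0} := ⟨a, ⟨b, hb, hab⟩, ha⟩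
    let b' : {x : A // x ∈ zeroDivisors A ∧ x ≠ 0} := ⟨b, ⟨a, ha, by rw [mul_comm, hab]⟩, hb⟩
    have h₁ : (zeroDivisorGraph A).edist u a' ≤ 1 := zeroDivisorGraph_edist_le_one hxa
    have h₂ : (zeroDivisorGraph A).edist a' b' ≤ 1 := zeroDivisorGraph_edist_le_one hab
    have h₃ : (zeroDivisorGraph A).edist b' v ≤ 1 :=
      zeroDivisorGraph_edist_le_one (by rw [mul_comm]; exact hyb)
    calc (zeroDivisorGraph A).edist u v
        ≤ (zeroDivisorGraph A).edist u a' + (zeroDivisorGraph A).edist a' v :=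
          SimpleGraph.edist_triangle
      _ ≤ (zeroDivisorGraph A).edist u a' +
          ((zeroDivisorGraph A).edist a' b' + (zeroDivisorGraph A).edist b' v) := by
          gcongr; exact SimpleGraph.edist_triangle
      _ ≤ 1 + (1 + 1) := by gcongr
      _ = 3 := by norm_num
  · let c : {x : A // x ∈ zeroDivisors A ∧ x ≠ 0} :=
      ⟨a * b, ⟨x, hx, by rw [mul_right_comm, mul_comm a, hxa, zero_mul]⟩, hab⟩
    have h₁ : (zeroDivisorGraph A).edist u c ≤ 1 :=
      zeroDivisorGraph_edist_le_one (by change x * (a * b) = 0; rw [← mul_assoc, hxa, zero_mul])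
    have h₂ : (zeroDivisorGraph A).edist c v ≤ 1 :=
      zeroDivisorGraph_edist_le_one (by
        change a * b * y = 0; rw [mul_assoc, mul_comm b, hyb, mul_zero])
    calc (zeroDivisorGraph A).edist u v
        ≤ (zeroDivisorGraph A).edist u c + (zeroDivisorGraph A).edist c v :=
          SimpleGraph.edist_triangle
      _ ≤ 1 + 1 := by gcongr
      _ ≤ 3 := by norm_num

theorem three_le_zeroDivisorGraph_ediam {A : Type*} [CommRing A] {x y : A}
    (hx : x ∈ zeroDivisors A) (hy : y ∈ zeroDivisors A) (hne : x ≠ y) (hxy : x * y ≠ 0)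
    (hann : ∀ z, x * z = 0 → y * z = 0 → z = 0) :
    3 ≤ (zeroDivisorGraph A).ediam := by
  have hx0 : x ≠ 0 := left_ne_zero_of_mul hxy
  have hy0 : y ≠ 0 := right_ne_zero_of_mul hxy
  let u : {x : A // x ∈ zeroDivisors A ∧ x ≠ 0} := ⟨x, hx, hx0⟩
  let v : {x : A // x ∈ zeroDivisors A ∧ x ≠ 0} := ⟨y, hy, hy0⟩
  have h : 2 < (zeroDivisorGraph A).edist u v := by
    rw [SimpleGraph.two_lt_edist_iff]
    refine ⟨fun h => hne (congrArg Subtype.val h), fun h => hxy h.2, ?_⟩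
    rw [Set.eq_empty_iff_forall_notMem]
    rintro z hz
    rw [SimpleGraph.mem_commonNeighbors] at hz
    exact z.2.2 (hann z hz.1.2 hz.2.2)
  have h3 : (3 : ℕ∞) ≤ (zeroDivisorGraph A).edist u v := by
    have := Order.add_one_le_of_lt h
    norm_num at this
    exact this
  exact h3.trans SimpleGraph.edist_le_ediam

theorem mem_zeroDivisors_iff_not_isUnit {A : Type*} [CommRing A] [Finite A] {x : A} :
    x ∈ zeroDivisors A ↔ ¬ IsUnit x := by
  rw [zeroDivisors_eq_compl, isUnit_iff_mem_nonZeroDivisors_of_finite]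
  rfl

/-- If the factor `e A` cut out by an idempotent `e ≠ 1` has a non-zero non-unit, then the diameter
is at least three. -/
theorem three_le_zeroDivisorGraph_ediam_of_isIdempotentElem {A : Type*} [CommRing A] [Finite A]
    {e a : A} (he : IsIdempotentElem e) (he1 : e ≠ 1) (hea : e * a ≠ 0)
    (hdvd : ¬ a ∣ e) : 3 ≤ (zeroDivisorGraph A).ediam := by
  have hee : e * e = e := he
  have h1e : 1 - e ≠ 0 := sub_ne_zero.mpr he1.symm
  have hxy : (e * a + (1 - e)) * e = e * a := by linear_combination (a - 1) * hee
  refine three_le_zeroDivisorGraph_ediam (x := e * a + (1 - e)) (y := e) ?_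
    ⟨1 - e, h1e, by linear_combination -hee⟩ ?_ (by rwa [hxy]) ?_
  · rw [mem_zeroDivisors_iff_not_isUnit]
    intro hu
    obtain ⟨c, hc⟩ := hu.exists_right_inv
    exact hdvd ⟨e * c, by linear_combination (-e) * hc + (a * c - c) * hee⟩
  · intro h
    exact h1e (by linear_combination (1 - e) * h + (a - 2) * hee)
  · intro z hxz hyz
    linear_combination hxz + (1 - a) * hyz

theorem zeroDivisorGraph_ediam_eq_three_of_isIdempotentElem {A : Type*} [CommRing A] [Finite A]
    {e a : A} (he : IsIdempotentElem e) (he0 : e ≠ 0) (he1 : e ≠ 1) (ha : a ≠ 0)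
    (hdvd : ¬ a ∣ e) (hdvd' : ¬ a ∣ 1 - e) : (zeroDivisorGraph A).ediam = 3 := by
  refine le_antisymm (zeroDivisorGraph_ediam_le_three A) ?_
  by_cases hea : e * a = 0
  · refine three_le_zeroDivisorGraph_ediam_of_isIdempotentElem he.one_sub
      (fun h => he0 (by linear_combination -h)) (fun h => ha ?_) hdvd'
    linear_combination h + hea
  · exact three_le_zeroDivisorGraph_ediam_of_isIdempotentElem he he1 hea hdvd

theorem exists_pow_isIdempotentElem {M : Type*} [Monoid M] [Finite M] (a : M) :
    ∃ n ≠ 0, IsIdempotentElem (a ^ n) := by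
  obtain ⟨i, j, hij, h⟩ : ∃ i j : ℕ, i < j ∧ a ^ i = a ^ j := by
    obtain ⟨i, j, hne, h⟩ := Finite.exists_ne_map_eq_of_infinite (fun n : ℕ => a ^ n)
    rcases hne.lt_or_gt with hlt | hlt
    · exact ⟨i, j, hlt, h⟩
    · exact ⟨j, i, hlt, h.symm⟩
  obtain ⟨p, rfl⟩ := Nat.exists_eq_add_of_lt hij
  -- The powers of `a` are periodic with period `p + 1` from the exponent `i` on.
  have hper : ∀ m k : ℕ, a ^ (i + m + k * (p + 1)) = a ^ (i + m) := by
    intro m k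
    induction k with
    | zero => simp
    | succ k ih =>
      rw [← ih, show i + m + (k + 1) * (p + 1) = i + p + 1 + (m + k * (p + 1)) by ring, pow_add,
        ← h, ← pow_add, ← add_assoc]
  -- A positive multiple of the period that is at least `i`.
  refine ⟨(i + 1) * (p + 1), by positivity, ?_⟩
  obtain ⟨m, hm⟩ : ∃ m, (i + 1) * (p + 1) = i + m := ⟨i * p + p + 1, by ring⟩
  have := hper m (i + 1)
  rw [← hm] at this
  rwa [IsIdempotentElem, ← pow_add]

theorem exists_pow_isIdempotentElem_ne {A : Type*} [CommRing A] [Finite A] {x : A}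
    (hnil : ¬ IsNilpotent x) (hunit : ¬ IsUnit x) :
    ∃ e : A, IsIdempotentElem e ∧ e ≠ 0 ∧ e ≠ 1 := by
  obtain ⟨n, hn, he⟩ := exists_pow_isIdempotentElem x
  exact ⟨x ^ n, he, fun h => hnil ⟨n, h⟩, fun h => hunit (.of_pow_eq_one h hn)⟩

/-- If the zero-divisors do not form an ideal, then a finite ring is not local, so it has a
non-trivial idempotent. -/
theorem exists_isIdempotentElem_of_zeroDivisors_not_ideal {R : Type*} [CommRing R] [Nontrivial R]
    [Finite R] (h : ¬ ∃ I : Ideal R, (I : Set R) = zeroDivisors R) :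
    ∃ e : R, IsIdempotentElem e ∧ e ≠ 0 ∧ e ≠ 1 := by
  obtain ⟨x, y, hx, hy, hxy⟩ : ∃ x y : R, ¬ IsUnit x ∧ ¬ IsUnit y ∧ IsUnit (x + y) := by
    by_contra! hadd
    refine h ⟨⟨⟨⟨zeroDivisors R, ?_⟩, ?_⟩, ?_⟩, rfl⟩
    · intro x y hx hy
      rw [mem_zeroDivisors_iff_not_isUnit] at *
      exact hadd x y hx hy
    · exact mem_zeroDivisors_iff_not_isUnit.mpr not_isUnit_zero
    · rintro c x ⟨y, hy, hxy⟩
      exact ⟨y, hy, by rw [smul_eq_mul, mul_assoc, hxy, mul_zero]⟩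
  refine exists_pow_isIdempotentElem_ne (fun hnil => hy ?_) hx
  have := hnil.neg.isUnit_add_right_of_commute hxy (Commute.all _ _)
  simpa using this

theorem corollary5p6 {R S : Type*} [CommRing R] [CommRing S] (f : R →+* S) (J : Ideal S)
    (hJ_ne_bot : J ≠ ⊥) (hJ_ne_top : J ≠ ⊤) (hfin : Finite (amalgamation f J)) :
    ((¬ ∃ I : Ideal R, (I : Set R) = zeroDivisors R) →
      (zeroDivisorGraph (amalgamation f J)).ediam = 3) ∧
    (¬ J ≤ nilradical S → J ⊓ nilradical S ≠ ⊥ →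
      (zeroDivisorGraph (amalgamation f J)).ediam = 3) := by
  have hS : Nontrivial S :=
    ⟨0, 1, fun h => hJ_ne_top ((Ideal.eq_top_iff_one J).mpr (h ▸ J.zero_mem))⟩
  have hR : Nontrivial R := f.domain_nontrivial
  let π : amalgamation f J →+* R := (RingHom.fst R S).comp (amalgamation f J).subtype
  let ι : R →+* amalgamation f J :=
    ((RingHom.id R).prod f).codRestrict (amalgamation f J)
      fun r => ⟨r, 0, J.zero_mem, by simp⟩
  have hπι : ∀ r, π (ι r) = r := fun r => rfl
  let inJ (j : S) (hj : j ∈ J) : amalgamation f J := ⟨(0, j), 0, j, hj, by simp⟩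
  have hπ_inJ : ∀ j hj, π (inJ j hj) = 0 := fun j hj => rfl
  have inJ_ne_zero : ∀ j hj, j ≠ 0 → inJ j hj ≠ 0 := fun j hj h h' =>
    h (congrArg (fun p : amalgamation f J => p.1.2) h')
  have isNilpotent_inJ : ∀ j hj, IsNilpotent (inJ j hj) ↔ IsNilpotent j := by
    intro j hj
    rw [← IsNilpotent.map_iff (f := (amalgamation f J).subtype) Subtype.val_injective]
    refine ⟨fun h => h.map (RingHom.snd R S), fun ⟨n, hn⟩ => ⟨n + 1, ?_⟩⟩
    exact Prod.ext (zero_pow n.succ_ne_zero) (by simp [inJ, pow_succ, hn])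
  refine ⟨fun hZ => ?_, fun hJ hJnil => ?_⟩
  · have : Finite R := Finite.of_injective ι (Function.LeftInverse.injective hπι)
    obtain ⟨r, hr, hr0, hr1⟩ := exists_isIdempotentElem_of_zeroDivisors_not_ideal hZ
    obtain ⟨j, hj, hj0⟩ := Submodule.exists_mem_ne_zero_of_ne_bot hJ_ne_bot
    refine zeroDivisorGraph_ediam_eq_three_of_isIdempotentElem (e := ι r) (a := inJ j hj)
      (hr.map ι) (fun h => hr0 ?_) (fun h => hr1 ?_) (inJ_ne_zero j hj hj0)
      (fun h => hr0 ?_) (fun h => hr1 ?_)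
    · simpa [hπι] using congrArg π h
    · simpa [hπι] using congrArg π h
    · simpa [hπι, hπ_inJ] using map_dvd π h
    · have := map_dvd π h
      rw [hπ_inJ j hj, zero_dvd_iff, map_sub, map_one, hπι, sub_eq_zero] at this
      exact this.symm
  · obtain ⟨j, hj, hjnil⟩ := SetLike.not_le_iff_exists.mp hJ
    obtain ⟨k, ⟨hk, hknil⟩, hk0⟩ := Submodule.exists_mem_ne_zero_of_ne_bot hJnil
    have hknil' : IsNilpotent (inJ k hk) := (isNilpotent_inJ k hk).mpr hknil
    obtain ⟨e, he, he0, he1⟩ := exists_pow_isIdempotentElem_ne (x := inJ j hj)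
      (fun h => hjnil ((isNilpotent_inJ j hj).mp h))
      (fun h => not_isUnit_zero (hπ_inJ j hj ▸ h.map π))
    -- A multiple of a nilpotent element is nilpotent, and a nilpotent idempotent is zero.
    have hdvd : ∀ e', IsIdempotentElem e' → e' ≠ 0 → ¬ inJ k hk ∣ e' := by
      rintro e' he' he0' ⟨c, hc⟩
      obtain ⟨n, hn⟩ : IsNilpotent e' :=
        hc ▸ (Commute.all (inJ k hk) c).isNilpotent_mul_right hknil'
      have hn' : e' ^ (n + 1) = 0 := by rw [pow_succ, hn, zero_mul]
      exact he0' (he'.pow_succ_eq n ▸ hn')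
    exact zeroDivisorGraph_ediam_eq_three_of_isIdempotentElem he he0 he1 (inJ_ne_zero k hk hk0)
      (hdvd e he he0) (hdvd (1 - e) he.one_sub (sub_ne_zero.mpr he1.symm))
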